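/- Let $S$ be a finite lattice with the discrete topology, and let $X \subseteq S^{\mathbb Z}$ be a cellwise lattice subshift, that is, a closed set with $\sigma(X)=X$ for the shift map $\sigma(x)_i = x_{i+1}$, such that $x\wedge y\in X$ and $x \vee y \in X$ for all $x,y\in X$, where $\wedge$ and $\vee$ are taken coordinatewise. For $a\in S$ define configurations $m^a, M^a\in S^{\mathbb Z}$ by $$m^a_i=\bigwedge_{x\in X,\ x_0\ge a} x_i,\qquad M^a_i=\bigvee_{x\in X,\ x_0\le a} x_i\qquad(i\in\mathbb Z),$$ where the empty meet is the greatest element of $S$ and the empty join is the least element of $S$. Call $X$ sofic if it is the set of all label sequences of bi-infinite paths in some finite directed graph with edges labeled by elements of $S$. Call a configuration $x\in S^{\mathbb Z}$ eventually periodic in both directions if there are integers $p,q\geq 1$ and $N,N'$ such that $x_{i+p}=x_i$ for all $i\ge N$ and $x_{i-q}=x_i$ for all $i\le N'$. Then: 1. $X$ is sofic if and only if $m^a$ is eventually periodic in both directions for every $a\in S$. 2. $X$ is sofic if and only if $M^a$ is eventually periodic in both directions for every $a\in S$. -/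

import Mathlib

open SymbolicDynamics.FullShift

namespace LatticeSubshift

/-- A finite directed graph whose edges are labelled by symbols of `S`
(loops and parallel edges are allowed). -/
structure LabeledGraph (S : Type*) where
  /-- vertices -/
  V : Type
  /-- edges -/
  E : Type
  [finiteV : Finite V]
  [finiteE : Finite E]
  /-- initial vertex of an edge -/
  source : E → V
  /-- terminal vertex of an edge -/
  target : E → V
  /-- label of an edge -/
  label : E → S

/-- The set of label sequences of the bi-infinite paths of a labelled graph. -/
def LabeledGraph.presented {S : Type*} (G : LabeledGraph S) : Set (ℤ → S) :=
  {x | ∃ e : ℤ → G.E, (∀ i, G.target (e i) = G.source (e (i + 1))) ∧ ∀ i, G.label (e i) = x i}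

/-- A set of configurations is sofic if it is presented by a finite labelled graph. -/
def IsSofic {S : Type*} (X : Set (ℤ → S)) : Prop :=
  ∃ G : LabeledGraph S, X = G.presented

/-- The configuration `x` is eventually periodic in both directions
(the two periods may differ). -/
def EventuallyPeriodicBoth {S : Type*} (x : ℤ → S) : Prop :=
  (∃ p : ℤ, 0 < p ∧ ∃ N : ℤ, ∀ i, N ≤ i → x (i + p) = x i) ∧
  (∃ q : ℤ, 0 < q ∧ ∃ N : ℤ, ∀ i, i ≤ N → x (i - q) = x i)

/-- The configuration `m^a`: its entry at `i` is the meet of all `x i` with `x ∈ X`, `a ≤ x 0`.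
The empty meet is the greatest element of the finite lattice `S`. -/
noncomputable def lowerConfig {S : Type*} [Lattice S] [Finite S]
    (X : Set (ℤ → S)) (a : S) (i : ℤ) : S :=
  haveI : Nonempty S := ⟨a⟩
  letI : Fintype S := Fintype.ofFinite S
  letI : CompleteLattice S := Fintype.toCompleteLatticeOfNonempty S
  sInf {s | ∃ x ∈ X, a ≤ x 0 ∧ x i = s}

/-- The configuration `M^a`: its entry at `i` is the join of all `x i` with `x ∈ X`, `x 0 ≤ a`.
The empty join is the least element of the finite lattice `S`. -/
noncomputable def upperConfig {S : Type*} [Lattice S] [Finite S]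
    (X : Set (ℤ → S)) (a : S) (i : ℤ) : S :=
  haveI : Nonempty S := ⟨a⟩
  letI : Fintype S := Fintype.ofFinite S
  letI : CompleteLattice S := Fintype.toCompleteLatticeOfNonempty S
  sSup {s | ∃ x ∈ X, x 0 ≤ a ∧ x i = s}

/-- The order on `S` in these definitions is the given one. -/
theorem isGLB_lowerConfig {S : Type*} [Lattice S] [Finite S]
    (X : Set (ℤ → S)) (a : S) (i : ℤ) :
    IsGLB {s | ∃ x ∈ X, a ≤ x 0 ∧ x i = s} (lowerConfig X a i) := by
  haveI : Nonempty S := ⟨a⟩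
  letI : Fintype S := Fintype.ofFinite S
  letI : CompleteLattice S := Fintype.toCompleteLatticeOfNonempty S
  exact isGLB_sInf _

theorem isLUB_upperConfig {S : Type*} [Lattice S] [Finite S]
    (X : Set (ℤ → S)) (a : S) (i : ℤ) :
    IsLUB {s | ∃ x ∈ X, x 0 ≤ a ∧ x i = s} (upperConfig X a i) := by
  haveI : Nonempty S := ⟨a⟩
  letI : Fintype S := Fintype.ofFinite S
  letI : CompleteLattice S := Fintype.toCompleteLatticeOfNonempty S
  exact isLUB_sSup _

end LatticeSubshift

/-! A lattice subshift is cut out by pairwise constraints: besides every symbol being dominated at 0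
by some point of `X`, membership of `x` means `m (x i) (j - i) ≤ x j` for all `i`, `j` (`lower_le`,
`mem_of_forall_lower_le`). If the `m a` are eventually periodic, they have finitely many one-sided
tails, so a finite graph can carry the pending bounds as its states. Conversely, in a sofic shift
the edges reachable at time `n` evolve deterministically in a finite power set, so the symbol sets
whose meets are `m a i` are eventually periodic. The claim for joins is the order dual. -/

namespace LatticeSubshift

/-! ### Label sets of a finite graph are eventually periodic -/

section Graph

variable {S : Type*}

/-- A bi-infinite path of a labelled graph. -/
def LabeledGraph.IsPath (G : LabeledGraph S) (e : ℤ → G.E) : Prop :=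
  ∀ i, G.target (e i) = G.source (e (i + 1))

theorem LabeledGraph.IsPath.shift {G : LabeledGraph S} {e : ℤ → G.E} (he : G.IsPath e) (n : ℤ) :
    G.IsPath (fun i => e (i + n)) := fun i => by
  have := he (i + n)
  rwa [add_right_comm] at this

/-- The edges traversed at time `n` by the paths whose label at time `0` is in `A`. -/
def LabeledGraph.reach (G : LabeledGraph S) (A : Set S) (n : ℤ) : Set G.E :=
  {f | ∃ e, G.IsPath e ∧ G.label (e 0) ∈ A ∧ e n = f}

/-- The edges following an edge of `R` on some bi-infinite path. -/
def LabeledGraph.step (G : LabeledGraph S) (R : Set G.E) : Set G.E :=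
  {f | ∃ e, G.IsPath e ∧ e 0 ∈ R ∧ e 1 = f}

/-- Paths through a common edge can be spliced there. As `0 ≤ n`, the splice keeps the edge at time
0. -/
theorem LabeledGraph.reach_succ (G : LabeledGraph S) (A : Set S) {n : ℤ} (hn : 0 ≤ n) :
    G.reach A (n + 1) = G.step (G.reach A n) := by
  ext f
  constructor
  · rintro ⟨e, he, h0, rfl⟩
    refine ⟨fun i => e (i + n), he.shift n, ⟨e, he, h0, by simp⟩, by simp [add_comm]⟩
  · rintro ⟨e, he, ⟨d, hd, h0, hdn⟩, rfl⟩
    refine ⟨fun i => if i ≤ n then d i else e (i - n), fun i => ?_, by simpa [hn] using h0,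
      by simp⟩
    rcases lt_trichotomy i n with h | h | h
    · simpa [h.le, Int.add_one_le_iff.2 h] using hd i
    · subst h
      simpa [hdn] using he 0
    · have h1 : ¬ i ≤ n := by omega
      have h2 : ¬ i + 1 ≤ n := by omega
      have h3 : i + 1 - n = i - n + 1 := by ring
      simpa [h1, h2, h3] using he (i - n)

theorem LabeledGraph.exists_period_reach (G : LabeledGraph S) (A : Set S) :
    ∃ p : ℤ, 0 < p ∧ ∃ N : ℤ, ∀ i, N ≤ i → G.reach A (i + p) = G.reach A i := by
  have := G.finiteE
  obtain ⟨k, l, hkl, h⟩ : ∃ k l : ℕ, k < l ∧ G.reach A k = G.reach A l := by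
    obtain ⟨k, l, hne, h⟩ := Finite.exists_ne_map_eq_of_infinite fun n : ℕ => G.reach A n
    rcases hne.lt_or_gt with hlt | hlt
    exacts [⟨k, l, hlt, h⟩, ⟨l, k, hlt, h.symm⟩]
  refine ⟨l - k, by omega, k, fun i hi => ?_⟩
  induction i, hi using Int.leInduction with
  | base => rw [add_sub_cancel, h]
  | succ i hi ih =>
    rw [add_right_comm, G.reach_succ A (by omega), G.reach_succ A (by omega), ih]

theorem LabeledGraph.image_label_reach (G : LabeledGraph S) (A : Set S) (n : ℤ) :
    G.label '' G.reach A n = {s | ∃ x ∈ G.presented, x 0 ∈ A ∧ x n = s} := by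
  ext s
  constructor
  · rintro ⟨f, ⟨e, he, h0, rfl⟩, rfl⟩
    exact ⟨fun i => G.label (e i), ⟨e, he, fun _ => rfl⟩, h0, rfl⟩
  · rintro ⟨x, ⟨e, he, hl⟩, h0, rfl⟩
    exact ⟨e n, ⟨e, he, by rwa [hl], rfl⟩, hl n⟩

/-- The graph with all its edges reversed. -/
def LabeledGraph.reverse (G : LabeledGraph S) : LabeledGraph S :=
  haveI := G.finiteV
  haveI := G.finiteE
  { V := G.V, E := G.E, source := G.target, target := G.source, label := G.label }

theorem LabeledGraph.mem_presented_reverse (G : LabeledGraph S) {x : ℤ → S}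
    (hx : x ∈ G.presented) : (fun i => x (-i)) ∈ G.reverse.presented := by
  obtain ⟨e, he, hl⟩ := hx
  refine ⟨fun i => e (-i), fun i => ?_, fun i => hl (-i)⟩
  have := he (-(i + 1))
  rw [neg_add, neg_add_cancel_right, ← neg_add] at this
  exact this.symm

theorem LabeledGraph.setOf_presented_reverse (G : LabeledGraph S) (A : Set S) (n : ℤ) :
    {s | ∃ x ∈ G.reverse.presented, x 0 ∈ A ∧ x n = s} =
      {s | ∃ x ∈ G.presented, x 0 ∈ A ∧ x (-n) = s} := by
  ext s
  constructor
  · rintro ⟨x, hx, h0, rfl⟩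
    exact ⟨fun i => x (-i), G.reverse.mem_presented_reverse hx, by simpa using h0, by simp⟩
  · rintro ⟨x, hx, h0, rfl⟩
    exact ⟨fun i => x (-i), G.mem_presented_reverse hx, by simpa using h0, rfl⟩

/-- In a sofic shift, the set of symbols that can occur at distance `i` from a symbol in `A`
is eventually periodic in `i`, in both directions. -/
theorem IsSofic.eventuallyPeriodicBoth {X : Set (ℤ → S)} (hX : IsSofic X) (A : Set S) :
    EventuallyPeriodicBoth fun i => {s | ∃ x ∈ X, x 0 ∈ A ∧ x i = s} := by
  obtain ⟨G, rfl⟩ := hX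
  constructor
  · obtain ⟨p, hp, N, h⟩ := G.exists_period_reach A
    refine ⟨p, hp, N, fun i hi => ?_⟩
    simp only [← G.image_label_reach, h i hi]
  · obtain ⟨p, hp, N, h⟩ := G.reverse.exists_period_reach A
    refine ⟨p, hp, -N, fun i hi => ?_⟩
    have key := G.setOf_presented_reverse A
    simp only [← G.reverse.image_label_reach] at key
    have h1 := key (-i + p)
    rw [h (-i) (by omega), key (-i), neg_neg, show -(-i + p) = i - p by ring] at h1
    exact h1.symm

theorem EventuallyPeriodicBoth.of_determined {T : Type*} {x : ℤ → S} {y : ℤ → T}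
    (hx : EventuallyPeriodicBoth x) (h : ∀ i j, x i = x j → y i = y j) :
    EventuallyPeriodicBoth y := by
  obtain ⟨⟨p, hp, N, hN⟩, q, hq, M, hM⟩ := hx
  exact ⟨⟨p, hp, N, fun i hi => h _ _ (hN i hi)⟩, q, hq, M, fun i hi => h _ _ (hM i hi)⟩

/-- A graph with vertices and edges in arbitrary universes still presents a sofic shift. -/
theorem isSofic_of_graph {V E : Type*} [Finite V] [Finite E] (source target : E → V)
    (label : E → S) :
    IsSofic {x | ∃ e : ℤ → E, (∀ i, target (e i) = source (e (i + 1))) ∧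
      ∀ i, label (e i) = x i} := by
  let v := Finite.equivFin V
  let c := Finite.equivFin E
  refine ⟨{ V := Fin (Nat.card V), E := Fin (Nat.card E), source := fun e => v (source (c.symm e)),
            target := fun e => v (target (c.symm e)), label := fun e => label (c.symm e) }, ?_⟩
  ext x
  constructor
  · rintro ⟨e, he, hl⟩
    exact ⟨fun i => c (e i), fun i => by simpa using he i, fun i => by simpa using hl i⟩
  · rintro ⟨e, he, hl⟩
    exact ⟨fun i => c.symm (e i), fun i => v.injective (he i), hl⟩

end Graph

/-! ### Eventually periodic sequences have finitely many tails -/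

theorem finite_range_tails {S : Type*} {u : ℕ → S} {p N : ℕ} (hp : 0 < p)
    (h : ∀ n, N ≤ n → u (n + p) = u n) : (Set.range fun k n => u (n + k)).Finite := by
  refine ((Set.finite_lt_nat (N + p)).image fun k n => u (n + k)).subset ?_
  rintro _ ⟨k, rfl⟩
  induction k using Nat.strong_induction_on with
  | _ k ih =>
    by_cases hk : k < N + p
    · exact ⟨k, hk, rfl⟩
    · obtain ⟨l, hl, heq⟩ := ih (k - p) (by omega)
      refine ⟨l, hl, heq.trans (funext fun n => ?_)⟩
      have := h (n + (k - p)) (by omega)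
      rw [show n + (k - p) + p = n + k by omega] at this
      exact this.symm

theorem EventuallyPeriodicBoth.finite_range_right {S : Type*} {x : ℤ → S}
    (hx : EventuallyPeriodicBoth x) :
    (Set.range fun (k : ℕ) (n : ℕ) => x ((n + k : ℕ) : ℤ)).Finite := by
  obtain ⟨⟨p, hp, N, h⟩, -⟩ := hx
  refine finite_range_tails (u := fun n : ℕ => x n) (p := p.toNat) (N := N.toNat) (by omega) ?_
  intro n hn
  have := h n (by omega)
  rwa [show ((n : ℤ) + p) = ((n + p.toNat : ℕ) : ℤ) by omega] at this

theorem EventuallyPeriodicBoth.finite_range_left {S : Type*} {x : ℤ → S}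
    (hx : EventuallyPeriodicBoth x) :
    (Set.range fun (k : ℕ) (n : ℕ) => x (-((n + k : ℕ) : ℤ))).Finite := by
  obtain ⟨-, q, hq, N, h⟩ := hx
  refine finite_range_tails (u := fun n : ℕ => x (-(n : ℤ))) (p := q.toNat) (N := (-N).toNat)
    (by omega) ?_
  intro n hn
  have := h (-n) (by omega)
  rwa [show (-(n : ℤ) - q) = -((n + q.toNat : ℕ) : ℤ) by omega] at this

/-! ### Lattice subshifts are determined by their lower configurations -/

section Lattice

theorem lower_le {S : Type*} [Lattice S] {X : Set (ℤ → S)} {m : S → ℤ → S}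
    (hshift : ∀ (g : ℤ), ∀ x ∈ X, (fun i => x (g + i)) ∈ X)
    (hm : ∀ a i, IsGLB {s | ∃ x ∈ X, a ≤ x 0 ∧ x i = s} (m a i)) {x : ℤ → S} (hx : x ∈ X)
    (i j : ℤ) : m (x i) (j - i) ≤ x j :=
  (hm (x i) (j - i)).1 ⟨_, hshift i x hx, by simp, by simp⟩

variable {S : Type*} [Lattice S] [Finite S] {X : Set (ℤ → S)} {m : S → ℤ → S}

/-- On a finite window, the lower configuration `m a` is attained by an element of `X`. -/
theorem exists_eqOn_lower (hinf : InfClosed X)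
    (hm : ∀ a i, IsGLB {s | ∃ x ∈ X, a ≤ x 0 ∧ x i = s} (m a i)) {a : S}
    (ha : ∃ y ∈ X, a ≤ y 0) (I : Finset ℤ) :
    ∃ y ∈ X, a ≤ y 0 ∧ ∀ i ∈ I, y i = m a i := by
  let r : (ℤ → S) → I → S := fun y i => y i
  have hne : {y | y ∈ X ∧ a ≤ y 0}.Nonempty := ha
  -- Closure under meets makes a minimal restriction to the window a least one.
  obtain ⟨-, ⟨⟨y, ⟨hy, hay⟩, rfl⟩, hmin⟩⟩ :=
    (Set.toFinite (r '' {y | y ∈ X ∧ a ≤ y 0})).exists_minimal (hne.image r)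
  refine ⟨y, hy, hay, fun i hi => ?_⟩
  suffices h : IsLeast {s | ∃ x ∈ X, a ≤ x 0 ∧ x i = s} (y i) from h.isGLB.unique (hm a i)
  refine ⟨⟨y, hy, hay, rfl⟩, ?_⟩
  rintro _ ⟨z, hz, haz, rfl⟩
  have hle : r (y ⊓ z) ≤ r y := fun j => inf_le_left
  have hmem : r (y ⊓ z) ∈ r '' {y | y ∈ X ∧ a ≤ y 0} :=
    Set.mem_image_of_mem r ⟨hinf hy hz, le_inf hay haz⟩
  exact (hmin hmem hle ⟨i, hi⟩).trans inf_le_right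

/-- By closedness it is enough to match `x` on finite windows. `hex` rules out empty meets, which no
point of `X` need attain. -/
theorem mem_of_forall_lower_le [TopologicalSpace S] [DiscreteTopology S]
    (hclosed : IsClosed X) (hshift : ∀ (g : ℤ), ∀ x ∈ X, (fun i => x (g + i)) ∈ X)
    (hX : IsSublattice X)
    (hm : ∀ a i, IsGLB {s | ∃ x ∈ X, a ≤ x 0 ∧ x i = s} (m a i)) {x : ℤ → S}
    (hex : ∀ i, ∃ y ∈ X, x i ≤ y 0) (hx : ∀ i j, m (x i) (j - i) ≤ x j) : x ∈ X := by
  rw [← hclosed.closure_eq, mem_closure_iff_nhds]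
  intro U hU
  rw [nhds_pi, Filter.mem_pi'] at hU
  obtain ⟨I, t, ht, hI⟩ := hU
  suffices ∃ z ∈ X, ∀ i ∈ I, z i = x i by
    obtain ⟨z, hz, hzx⟩ := this
    exact ⟨z, hI fun i hi => by rw [hzx i hi]; exact mem_of_mem_nhds (ht i), hz⟩
  rcases I.eq_empty_or_nonempty with rfl | hne
  · obtain ⟨y, hy, -⟩ := hex 0
    exact ⟨y, hy, by simp⟩
  choose y hyX hy0 hym using fun i => exists_eqOn_lower hX.infClosed hm (hex i) (I.image (· - i))
  -- Term `i` is a copy of `m (x i)` centred at `i`. At `j` every term is at most `x j`, and the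
  -- term `i = j` is at least `x j`.
  refine ⟨I.sup' hne fun i j => y i (-i + j), ?_, fun j hj => ?_⟩
  · exact hX.supClosed.finsetSup'_mem hne fun i _ => hshift (-i) _ (hyX i)
  · rw [Finset.sup'_apply]
    apply le_antisymm
    · refine Finset.sup'_le _ _ fun i _ => ?_
      rw [neg_add_eq_sub, hym i (j - i) (Finset.mem_image_of_mem _ hj)]
      exact hx i j
    · refine le_trans ?_ (Finset.le_sup' (fun i => y i (-i + j)) hj)
      simpa using hy0 j

theorem isSofic_of_lower_eventuallyPeriodicBoth [TopologicalSpace S] [DiscreteTopology S]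
    (hclosed : IsClosed X) (hshift : ∀ (g : ℤ), ∀ x ∈ X, (fun i => x (g + i)) ∈ X)
    (hX : IsSublattice X)
    (hm : ∀ a i, IsGLB {s | ∃ x ∈ X, a ≤ x 0 ∧ x i = s} (m a i))
    (hper : ∀ a, EventuallyPeriodicBoth (m a)) : IsSofic X := by
  let Fw : Set (ℕ → S) := ⋃ a, Set.range fun (k : ℕ) (n : ℕ) => m a ((n + k : ℕ) : ℤ)
  let Bw : Set (ℕ → S) := ⋃ a, Set.range fun (k : ℕ) (n : ℕ) => m a (-((n + k : ℕ) : ℤ))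
  have hFw : Fw.Finite := Set.finite_iUnion fun a => (hper a).finite_range_right
  have hBw : Bw.Finite := Set.finite_iUnion fun a => (hper a).finite_range_left
  let tail : (ℕ → S) → ℕ → S := fun f n => f (n + 1)
  have : Finite {P : Set (ℕ → S) // P ⊆ Fw} := hFw.finite_subsets.to_subtype
  have : Finite {Q : Set (ℕ → S) // Q ⊆ Bw} := hBw.finite_subsets.to_subtype
  -- A state consists of pending lower bounds for the future and for the past.
  let V := {P : Set (ℕ → S) // P ⊆ Fw} × {Q : Set (ℕ → S) // Q ⊆ Bw}
  -- Bounds on the future pass from `v` to `w`, bounds on the past from `w` to `v`. Each is checked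
  -- against `s` at its head, then shortened; `s` adds its own tails, starting at distance 1.
  let ok : V → S → V → Prop := fun v s w =>
    (∃ y ∈ X, s ≤ y 0) ∧ m s 0 ≤ s ∧
    (∀ f ∈ v.1.1, f 0 ≤ s ∧ tail f ∈ w.1.1) ∧ (fun n : ℕ => m s (n + 1 : ℕ)) ∈ w.1.1 ∧
    (∀ f ∈ w.2.1, f 0 ≤ s ∧ tail f ∈ v.2.1) ∧ (fun n : ℕ => m s (-(n + 1 : ℕ))) ∈ v.2.1
  let E := {e : V × S × V // ok e.1 e.2.1 e.2.2}
  have : Finite V := inferInstanceAs (Finite (_ × _))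
  have : Finite E := inferInstanceAs (Finite (Subtype _))
  convert isSofic_of_graph (fun e : E => e.1.1) (fun e : E => e.1.2.2) (fun e : E => e.1.2.1)
  ext x
  constructor
  · intro hx
    -- The largest states compatible with `x`: all available tails lying below it from `i` onwards,
    -- or from `i - 1` backwards.
    let v : ℤ → V := fun i =>
      (⟨{f | f ∈ Fw ∧ ∀ n : ℕ, f n ≤ x (i + n)}, fun f hf => hf.1⟩,
       ⟨{f | f ∈ Bw ∧ ∀ n : ℕ, f n ≤ x (i - 1 - n)}, fun f hf => hf.1⟩)
    have hFtail : ∀ f ∈ Fw, tail f ∈ Fw := by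
      intro f hf
      obtain ⟨a, k, rfl⟩ := Set.mem_iUnion.1 hf
      exact Set.mem_iUnion.2 ⟨a, k + 1, funext fun n => by
        simp only [tail]; congr 2; omega⟩
    have hBtail : ∀ f ∈ Bw, tail f ∈ Bw := by
      intro f hf
      obtain ⟨a, k, rfl⟩ := Set.mem_iUnion.1 hf
      exact Set.mem_iUnion.2 ⟨a, k + 1, funext fun n => by
        simp only [tail]; congr 3; omega⟩
    have hv : ∀ i, ok (v i) (x i) (v (i + 1)) := by
      intro i
      refine ⟨⟨_, hshift i x hx, by simp⟩, by simpa using lower_le hshift hm hx i i, ?_, ?_, ?_, ?_⟩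
      · rintro f ⟨hf, hfx⟩
        refine ⟨by simpa using hfx 0, hFtail f hf, fun n => ?_⟩
        have := hfx (n + 1)
        rwa [show i + ((n + 1 : ℕ) : ℤ) = i + 1 + n by push_cast; ring] at this
      · refine ⟨Set.mem_iUnion.2 ⟨x i, 1, rfl⟩, fun n => ?_⟩
        have := lower_le hshift hm hx i (i + 1 + n)
        rwa [show i + 1 + (n : ℤ) - i = ((n + 1 : ℕ) : ℤ) by push_cast; ring] at this
      · rintro f ⟨hf, hfx⟩
        refine ⟨by simpa using hfx 0, hBtail f hf, fun n => ?_⟩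
        have := hfx (n + 1)
        rwa [show i + 1 - 1 - ((n + 1 : ℕ) : ℤ) = i - 1 - n by push_cast; ring] at this
      · refine ⟨Set.mem_iUnion.2 ⟨x i, 1, rfl⟩, fun n => ?_⟩
        have := lower_le hshift hm hx i (i - 1 - n)
        rwa [show i - 1 - (n : ℤ) - i = -((n + 1 : ℕ) : ℤ) by push_cast; ring] at this
    exact ⟨fun i => ⟨(v i, x i, v (i + 1)), hv i⟩, fun _ => rfl, fun _ => rfl⟩
  · rintro ⟨e, he, hl⟩
    have hok : ∀ i, ok (e i).1.1 (x i) (e (i + 1)).1.1 := fun i => by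
      have := (e i).2
      rwa [hl i, he i] at this
    -- The bound issued at `i` is still pending `k` edges later, its head now facing position `i + k
    -- + 1`.
    have hfw : ∀ (k : ℕ) (i : ℤ),
        (fun n : ℕ => m (x i) (n + k + 1 : ℕ)) ∈ (e (i + k + 1)).1.1.1.1 := by
      intro k i
      induction k with
      | zero => simpa using (hok i).2.2.2.1
      | succ k ih =>
        have := ((hok (i + k + 1)).2.2.1 _ ih).2
        rw [show i + ((k + 1 : ℕ) : ℤ) + 1 = i + k + 1 + 1 by push_cast; ring]
        convert this using 1
        funext n
        simp only [tail]
        congr 2; omega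
    have hbw : ∀ (k : ℕ) (i : ℤ),
        (fun n : ℕ => m (x i) (-(n + k + 1 : ℕ))) ∈ (e (i - k)).1.1.2.1 := by
      intro k i
      induction k with
      | zero => simpa using (hok i).2.2.2.2.2
      | succ k ih =>
        have h1 := hok (i - (k + 1 : ℕ))
        rw [show i - ((k + 1 : ℕ) : ℤ) + 1 = i - k by push_cast; ring] at h1
        have := (h1.2.2.2.2.1 _ ih).2
        convert this using 1
        funext n
        simp only [tail]
        congr 3; omega
    refine mem_of_forall_lower_le hclosed hshift hX hm (fun i => (hok i).1) fun i j => ?_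
    rcases lt_trichotomy i j with h | rfl | h
    · obtain ⟨k, rfl⟩ : ∃ k : ℕ, j = i + k + 1 := ⟨(j - i - 1).toNat, by omega⟩
      have := ((hok (i + k + 1)).2.2.1 _ (hfw k i)).1
      rwa [show i + (k : ℤ) + 1 - i = ((0 + k + 1 : ℕ) : ℤ) by push_cast; ring]
    · simpa using (hok i).2.1
    · obtain ⟨k, rfl⟩ : ∃ k : ℕ, j = i - k - 1 := ⟨(i - j - 1).toNat, by omega⟩
      have h1 := hok (i - k - 1)
      rw [sub_add_cancel] at h1
      have := (h1.2.2.2.2.1 _ (hbw k i)).1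
      rwa [show i - (k : ℤ) - 1 - i = -((0 + k + 1 : ℕ) : ℤ) by push_cast; ring]

/-- A lattice subshift is sofic if and only if its lower configurations are eventually periodic
in both directions. -/
theorem isSofic_iff_lower_eventuallyPeriodicBoth [TopologicalSpace S] [DiscreteTopology S]
    (hclosed : IsClosed X) (hshift : ∀ (g : ℤ), ∀ x ∈ X, (fun i => x (g + i)) ∈ X)
    (hX : IsSublattice X)
    (hm : ∀ a i, IsGLB {s | ∃ x ∈ X, a ≤ x 0 ∧ x i = s} (m a i)) :
    IsSofic X ↔ ∀ a, EventuallyPeriodicBoth (m a) := by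
  refine ⟨fun h a => ?_, isSofic_of_lower_eventuallyPeriodicBoth hclosed hshift hX hm⟩
  refine (h.eventuallyPeriodicBoth (Set.Ici a)).of_determined fun i j hij => ?_
  have h1 := hm a i
  change {s | ∃ x ∈ X, a ≤ x 0 ∧ x i = s} = {s | ∃ x ∈ X, a ≤ x 0 ∧ x j = s} at hij
  rw [hij] at h1
  exact h1.unique (hm a j)

end Lattice

end LatticeSubshift

theorem mainTheorem7 {S : Type*} [Lattice S] [Finite S] [TopologicalSpace S] [DiscreteTopology S]
    (X : Subshift S ℤ) (hX : IsSublattice X.carrier) :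
    (LatticeSubshift.IsSofic X.carrier ↔
      ∀ a : S, LatticeSubshift.EventuallyPeriodicBoth (LatticeSubshift.lowerConfig X.carrier a)) ∧
    (LatticeSubshift.IsSofic X.carrier ↔
      ∀ a : S, LatticeSubshift.EventuallyPeriodicBoth (LatticeSubshift.upperConfig X.carrier a)) := by
  have hshift : ∀ (g : ℤ), ∀ x ∈ X.carrier, (fun i => x (g + i)) ∈ X.carrier :=
    fun g x hx => X.mapsTo g hx
  refine ⟨LatticeSubshift.isSofic_iff_lower_eventuallyPeriodicBoth X.isClosed hshift hX
    (LatticeSubshift.isGLB_lowerConfig X.carrier), ?_⟩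
  have : DiscreteTopology Sᵒᵈ := ‹DiscreteTopology S›
  -- In `Sᵒᵈ` the least upper bounds defining `upperConfig` are the greatest lower bounds required
  -- of `m`.
  exact LatticeSubshift.isSofic_iff_lower_eventuallyPeriodicBoth (S := Sᵒᵈ) (X := X.carrier)
    X.isClosed hshift ⟨hX.infClosed, hX.supClosed⟩
    (LatticeSubshift.isLUB_upperConfig X.carrier)
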